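/- Let $\Xi\subset\mathbb{R}^p$ and let $\{f_c\}_{c\in\Xi}$ be a parametric family of probability densities on $\mathbb{R}^d$. Let $\mu_1,\mu_2,\dots$ be independent and identically distributed random measures on $\mathbb{R}^d$ (defined on a probability space $(\Omega,\mathcal F,\mathbb P)$), and put $$W^{(k)}_c=-\log\int f_c\,d\mu_k,\qquad Z^{(k)}_c=\frac{\partial}{\partial c}W^{(k)}_c\in\mathbb{R}^p,\qquad W_c=W_c^{(1)},\quad Z_c=Z_c^{(1)}.$$ Let $\xi\in\Xi$ be a minimizer of $c\mapsto\mathbb{E}[W_c]$ over $\Xi$, with $\mathbb{E}|W_\xi|<\infty$. Let $\tilde\xi_n$ be a Z-estimator, that is, a random vector which almost surely is a solution $c\in\Xi$ of $\sum_{k=1}^n Z^{(k)}_{c}=0$ whenever such a solution exists in $\Xi$, and assume that $\tilde\xi_n$ is consistent: $\tilde\xi_n\to\xi$ in probability. Assume that $\mathbb{E}\|Z_\xi\|^2<\infty$, that $\mathbb{E}[Z_c]$ exists for $c$ near $\xi$, and that the $p\times p$ matrix $$M_\xi=\frac{\partial}{\partial c^T}\mathbb{E}[Z_c]\Big|_{c=\xi}$$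 exists and is invertible. Assume moreover that there is an open neighborhood $U\subset\Xi$ of $\xi$ such that for every $k$, almost surely, $Z^{(k)}_c$ exists for all $c\in U$ (in particular $0<\int f_c\,d\mu_k<\infty$), the map $c\mapsto Z^{(k)}_c$ is differentiable on $U$, and its derivative $Z'^{(k)}_c=\frac{\partial}{\partial c^T}Z^{(k)}_c$ satisfies $$\|Z'^{(k)}_c-Z'^{(k)}_{c_1}\|\le H^{(k)}\|c-c_1\|\qquad\text{for all }c,c_1\in U$$ in matrix norm, where $H^{(k)}$ is an integrable random variable. Then, with $J_\xi=\mathbb{E}[Z_\xi Z_\xi^T]$, $$\sqrt n\,(\tilde\xi_n-\xi)\stackrel{d}{\longrightarrow}\mathrm{N}\big(0,\;M_\xi^{-1}J_\xi\,[M_\xi^{-1}]^T\big)\qquad(n\to\infty).$$ -/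

import Mathlib

open MeasureTheory ProbabilityTheory Filter
open scoped Topology ENNReal NNReal

noncomputable section

namespace InformedCensoring

variable {p d : ℕ} {Ω : Type*} [MeasurableSpace Ω]

/-- A parametric family of probability densities `f c` on `ℝ^d`, with parameter `c ∈ Ξ ⊆ ℝ^p`. -/
structure IsParametricDensity (Ξ : Set (EuclideanSpace ℝ (Fin p)))
    (f : EuclideanSpace ℝ (Fin p) → EuclideanSpace ℝ (Fin d) → ℝ≥0) : Prop where
  measurable : ∀ c ∈ Ξ, Measurable (f c)
  lintegral_eq_one : ∀ c ∈ Ξ, ∫⁻ x, (f c x : ℝ≥0∞) = 1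

/-- A sample of independent, identically distributed random measures on `ℝ^d`, that is, of
measurable maps into the space of measures with the σ-algebra generated by the evaluations. -/
structure IsRandomMeasureSample (P : Measure Ω)
    (μ : ℕ → Ω → Measure (EuclideanSpace ℝ (Fin d))) : Prop where
  measurable : ∀ k, Measurable (μ k)
  indep : iIndepFun μ P
  identDistrib : ∀ k, IdentDistrib (μ k) (μ 0) P P

/-- The contribution `∫ f_c dm` of one observed measure `m` to the generalized likelihood. -/
def likelihood (f : EuclideanSpace ℝ (Fin p) → EuclideanSpace ℝ (Fin d) → ℝ≥0)
    (m : Measure (EuclideanSpace ℝ (Fin d))) (c : EuclideanSpace ℝ (Fin p)) : ℝ≥0∞ :=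
  ∫⁻ x, (f c x : ℝ≥0∞) ∂m

/-- Integrating over the support of `m` only makes no difference. -/
theorem likelihood_eq_setLIntegral_support
    (f : EuclideanSpace ℝ (Fin p) → EuclideanSpace ℝ (Fin d) → ℝ≥0)
    (m : Measure (EuclideanSpace ℝ (Fin d))) (c : EuclideanSpace ℝ (Fin p)) :
    likelihood f m c = ∫⁻ x in m.support, (f c x : ℝ≥0∞) ∂m := by
  rw [likelihood, Measure.restrict_eq_self_of_ae_mem]
  exact Measure.support_mem_ae

/-- The loss `W_c = -log ∫ f_c dm`; it is meaningful if `0 < ∫ f_c dm < ∞`. -/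
def loss (f : EuclideanSpace ℝ (Fin p) → EuclideanSpace ℝ (Fin d) → ℝ≥0)
    (m : Measure (EuclideanSpace ℝ (Fin d))) (c : EuclideanSpace ℝ (Fin p)) : ℝ :=
  -Real.log (likelihood f m c).toReal

/-- `W_c` is finite. -/
def LossFinite (f : EuclideanSpace ℝ (Fin p) → EuclideanSpace ℝ (Fin d) → ℝ≥0)
    (m : Measure (EuclideanSpace ℝ (Fin d))) (c : EuclideanSpace ℝ (Fin p)) : Prop :=
  0 < likelihood f m c ∧ likelihood f m c < ∞

/-- The score `Z_c`: the derivative (gradient) of `W_c` with respect to the parameter `c ∈ Ξ`. -/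
def score (Ξ : Set (EuclideanSpace ℝ (Fin p)))
    (f : EuclideanSpace ℝ (Fin p) → EuclideanSpace ℝ (Fin d) → ℝ≥0)
    (m : Measure (EuclideanSpace ℝ (Fin d))) (c : EuclideanSpace ℝ (Fin p)) :
    EuclideanSpace ℝ (Fin p) :=
  gradientWithin (loss f m) Ξ c

/-- The score `Z_c` is well defined: `c ∈ Ξ`, near `c` the loss is finite, it is differentiable
at `c`, and derivatives within `Ξ` at `c` are unique (which is automatic if `c` is interior). -/
structure ScoreExists (Ξ : Set (EuclideanSpace ℝ (Fin p)))
    (f : EuclideanSpace ℝ (Fin p) → EuclideanSpace ℝ (Fin d) → ℝ≥0)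
    (m : Measure (EuclideanSpace ℝ (Fin d))) (c : EuclideanSpace ℝ (Fin p)) : Prop where
  mem : c ∈ Ξ
  uniqueDiff : UniqueDiffWithinAt ℝ Ξ c
  lossFinite : ∀ᶠ c' in 𝓝[Ξ] c, LossFinite f m c'
  differentiable : DifferentiableWithinAt ℝ (loss f m) Ξ c

/-- `ξ ∈ Ξ` minimizes the expected loss `E[W_c]`, which is finite at `ξ`, over all `c ∈ Ξ` with
finite expected loss. -/
structure IsPopulationMinimizer (P : Measure Ω) (Ξ : Set (EuclideanSpace ℝ (Fin p)))
    (f : EuclideanSpace ℝ (Fin p) → EuclideanSpace ℝ (Fin d) → ℝ≥0)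
    (μ : Ω → Measure (EuclideanSpace ℝ (Fin d))) (ξ : EuclideanSpace ℝ (Fin p)) : Prop where
  mem : ξ ∈ Ξ
  lossFinite : ∀ᵐ ω ∂P, LossFinite f (μ ω) ξ
  integrable : Integrable (fun ω => loss f (μ ω) ξ) P
  le : ∀ c ∈ Ξ, (∀ᵐ ω ∂P, LossFinite f (μ ω) c) → Integrable (fun ω => loss f (μ ω) c) P →
    ∫ ω, loss f (μ ω) ξ ∂P ≤ ∫ ω, loss f (μ ω) c ∂P

/-- `c ∈ Ξ` solves the estimating equation `∑ Z_c = 0` for the first `n` observed measures. -/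
def SolvesScoreEquation (Ξ : Set (EuclideanSpace ℝ (Fin p)))
    (f : EuclideanSpace ℝ (Fin p) → EuclideanSpace ℝ (Fin d) → ℝ≥0)
    (m : ℕ → Measure (EuclideanSpace ℝ (Fin d))) (n : ℕ) (c : EuclideanSpace ℝ (Fin p)) : Prop :=
  c ∈ Ξ ∧ (∀ k < n, ScoreExists Ξ f (m k) c) ∧ ∑ k ∈ Finset.range n, score Ξ f (m k) c = 0

/-- A sequence of Z-estimators: the `n`-th one is a random vector which solves the estimating
equation for the first `n` observations whenever a solution exists in `Ξ`. -/
structure IsZEstimator (P : Measure Ω) (Ξ : Set (EuclideanSpace ℝ (Fin p)))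
    (f : EuclideanSpace ℝ (Fin p) → EuclideanSpace ℝ (Fin d) → ℝ≥0)
    (μ : ℕ → Ω → Measure (EuclideanSpace ℝ (Fin d)))
    (est : ℕ → Ω → EuclideanSpace ℝ (Fin p)) : Prop where
  aemeasurable : ∀ n, AEMeasurable (est n) P
  solves : ∀ n, ∀ᵐ ω ∂P, (∃ c, SolvesScoreEquation Ξ f (fun k => μ k ω) n c) →
    SolvesScoreEquation Ξ f (fun k => μ k ω) n (est n ω)

/-- The expected score `E[Z_c]`. -/
def expectedScore (P : Measure Ω) (Ξ : Set (EuclideanSpace ℝ (Fin p)))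
    (f : EuclideanSpace ℝ (Fin p) → EuclideanSpace ℝ (Fin d) → ℝ≥0)
    (μ : Ω → Measure (EuclideanSpace ℝ (Fin d))) (c : EuclideanSpace ℝ (Fin p)) :
    EuclideanSpace ℝ (Fin p) :=
  ∫ ω, score Ξ f (μ ω) c ∂P

/-- The matrix `M_ξ = ∂ E[Z_c] / ∂ c^T` at `c = ξ`. -/
def matrixM (P : Measure Ω) (Ξ : Set (EuclideanSpace ℝ (Fin p)))
    (f : EuclideanSpace ℝ (Fin p) → EuclideanSpace ℝ (Fin d) → ℝ≥0)
    (μ : Ω → Measure (EuclideanSpace ℝ (Fin d))) (ξ : EuclideanSpace ℝ (Fin p)) :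
    Matrix (Fin p) (Fin p) ℝ :=
  Matrix.of fun i j =>
    (fderiv ℝ (expectedScore P Ξ f μ) ξ (EuclideanSpace.single j (1 : ℝ))) i

/-- The matrix `J_ξ = E[Z_ξ Z_ξ^T]`. -/
def matrixJ (P : Measure Ω) (Ξ : Set (EuclideanSpace ℝ (Fin p)))
    (f : EuclideanSpace ℝ (Fin p) → EuclideanSpace ℝ (Fin d) → ℝ≥0)
    (μ : Ω → Measure (EuclideanSpace ℝ (Fin d))) (ξ : EuclideanSpace ℝ (Fin p)) :
    Matrix (Fin p) (Fin p) ℝ :=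
  Matrix.of fun i j => ∫ ω, score Ξ f (μ ω) ξ i * score Ξ f (μ ω) ξ j ∂P

/-- The asymptotic covariance `V_ξ = M_ξ⁻¹ J_ξ (M_ξ⁻¹)^T`. -/
def matrixV (P : Measure Ω) (Ξ : Set (EuclideanSpace ℝ (Fin p)))
    (f : EuclideanSpace ℝ (Fin p) → EuclideanSpace ℝ (Fin d) → ℝ≥0)
    (μ : Ω → Measure (EuclideanSpace ℝ (Fin d))) (ξ : EuclideanSpace ℝ (Fin p)) :
    Matrix (Fin p) (Fin p) ℝ :=
  (matrixM P Ξ f μ ξ)⁻¹ * matrixJ P Ξ f μ ξ * ((matrixM P Ξ f μ ξ)⁻¹).transpose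

end InformedCensoring

end

namespace InformedCensoring


/-! Near `ξ` the averaged score is almost affine. With averages `S` of the scores at `ξ`, `B` of
their derivatives and `L` of the remainder constants, `F c = S + B (c - ξ)` up to an error `L ‖c -
ξ‖ ^ 2`. By the law of large numbers `S → 0`, `B → M_ξ` and `L` stays bounded. As `M_ξ` is
invertible, a quantitative inverse function argument gives a zero of `F` near `ξ` with probability
tending to one, so the estimator solves the equation. Consistency makes the error small relative to
`‖est n - ξ‖`, hence `√n (est n - ξ)` differs from `-√n M_ξ⁻¹ S` by a term vanishing in probability.
The central limit theorem and Slutsky's lemma conclude (`tendstoInDistribution_zEstimator`).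

Two points need care. The constants `H k` are not assumed identically distributed, so they are
replaced by the best constant `scoreRemainder`, a measurable function of `μ k` dominated by `|H k|`;
the score and its derivative likewise get measurable versions, so that all three sequences are
i.i.d. Moreover `E[Z_ξ] = 0` and `M_ξ = E[Z'_ξ]` have to be proved: pathwise Taylor bounds with
integrable constants are integrated (`expectedScore_eq_zero`, `hasFDerivAt_expectedScore`). -/

/-- The matrix of second moments of a random vector. -/
noncomputable def secondMoment {p : ℕ} {Ω : Type*} [MeasurableSpace Ω] (P : Measure Ω)
    (X : Ω → EuclideanSpace ℝ (Fin p)) : Matrix (Fin p) (Fin p) ℝ :=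
  Matrix.of fun i j => ∫ ω, X ω i * X ω j ∂P

/-! ### Second moments and the multivariate central limit theorem -/

section CLT

variable {p : ℕ} {Ω : Type*} [MeasurableSpace Ω] {P : Measure Ω}

lemma memLp_coord {X : Ω → EuclideanSpace ℝ (Fin p)} (hX : MemLp X 2 P) (i : Fin p) :
    MemLp (fun ω => X ω i) 2 P :=
  (EuclideanSpace.proj (𝕜 := ℝ) i).comp_memLp' hX

/-- Expanding the square gives the identity. It serves both semidefiniteness and the comparison of
Gaussian characteristic functions. -/
lemma dotProduct_secondMoment_mulVec {X : Ω → EuclideanSpace ℝ (Fin p)} (hX : MemLp X 2 P)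
    (t : EuclideanSpace ℝ (Fin p)) :
    dotProduct t.ofLp ((secondMoment P X).mulVec t.ofLp) = ∫ ω, (inner ℝ t (X ω)) ^ 2 ∂P := by
  have hint : ∀ i j, Integrable (fun ω => X ω i * X ω j) P := fun i j =>
    (memLp_coord hX i).integrable_mul (memLp_coord hX j)
  have h : ∀ ω, (inner ℝ t (X ω)) ^ 2 = ∑ i, ∑ j, t i * (X ω i * X ω j) * t j := by
    intro ω
    rw [PiLp.inner_apply, sq, Finset.sum_mul_sum]
    refine Finset.sum_congr rfl fun i _ => Finset.sum_congr rfl fun j _ => ?_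
    simp only [RCLike.inner_apply, conj_trivial]
    ring
  simp_rw [h]
  rw [integral_finsetSum _ fun i _ => integrable_finsetSum _ fun j _ =>
    ((hint i j).const_mul _).mul_const _]
  simp only [dotProduct, Matrix.mulVec, secondMoment, Matrix.of_apply, Finset.mul_sum]
  refine Finset.sum_congr rfl fun i _ => ?_
  rw [integral_finsetSum _ fun j _ => ((hint i j).const_mul _).mul_const _]
  refine Finset.sum_congr rfl fun j _ => ?_
  rw [integral_mul_const, integral_const_mul]
  ring

lemma posSemidef_secondMoment {X : Ω → EuclideanSpace ℝ (Fin p)} (hX : MemLp X 2 P) :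
    (secondMoment P X).PosSemidef := by
  refine Matrix.PosSemidef.of_dotProduct_mulVec_nonneg ?_ fun x => ?_
  · ext i j
    simp [secondMoment, Matrix.conjTranspose_apply, mul_comm]
  · have := dotProduct_secondMoment_mulVec hX (WithLp.toLp 2 x)
    simp only [star_trivial]
    rw [this]
    positivity

/-- **Multivariate central limit theorem** for independent, identically distributed, centred and
square integrable random vectors. -/
theorem tendstoInDistribution_inv_sqrt_smul_sum [IsProbabilityMeasure P]
    {X : ℕ → Ω → EuclideanSpace ℝ (Fin p)} (hX : MemLp (X 0) 2 P) (h0 : ∫ ω, X 0 ω ∂P = 0)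
    (hindep : iIndepFun X P) (hident : ∀ k, IdentDistrib (X k) (X 0) P P) :
    TendstoInDistribution (fun (n : ℕ) ω => (√(n : ℝ))⁻¹ • ∑ k ∈ Finset.range n, X k ω) atTop id
      (fun _ => P) (multivariateGaussian 0 (secondMoment P (X 0))) where
  forall_aemeasurable n :=
    (Finset.aemeasurable_fun_sum _ fun _ _ => (hident _).aemeasurable_fst).fun_const_smul _
  tendsto := by
    refine ProbabilityMeasure.tendsto_of_tendsto_charFun fun t => ?_
    have hS : ∀ n : ℕ, AEMeasurable (fun ω => (√(n : ℝ))⁻¹ • ∑ k ∈ Finset.range n, X k ω) P :=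
      fun n => (Finset.aemeasurable_fun_sum _ fun _ _ => (hident _).aemeasurable_fst).fun_const_smul
          _
    have hmt : Measurable fun x : EuclideanSpace ℝ (Fin p) => inner ℝ t x := by fun_prop
    let T : ℕ → Ω → ℝ := fun k ω => inner ℝ t (X k ω)
    have hT0 : MemLp (T 0) 2 P := (innerSL ℝ t).comp_memLp' hX
    have hTi : iIndepFun T P := hindep.comp (fun _ x => inner ℝ t x) fun _ => hmt
    have hTd : ∀ k, IdentDistrib (T k) (T 0) P P := fun k => (hident k).comp hmt
    have hTm : P[T 0] = 0 := by
      have := integral_inner (𝕜 := ℝ) (hX.integrable (by norm_num)) t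
      simp only [T]
      rw [this, h0, inner_zero_right]
    have hvar : Var[T 0; P] = ∫ ω, (inner ℝ t (X 0 ω)) ^ 2 ∂P := by
      rw [variance_of_integral_eq_zero hT0.aestronglyMeasurable.aemeasurable hTm]
    have hlaw : HasLaw (id : ℝ → ℝ) (gaussianReal 0 Var[T 0; P].toNNReal)
        (gaussianReal 0 Var[T 0; P].toNNReal) := ⟨aemeasurable_id, by simp⟩
    -- Cramér–Wold: the characteristic function of a vector at `t` is that of its projection `⟨t,
    -- ·⟩` at `1`, so the scalar theorem suffices.
    have key := (ProbabilityMeasure.tendsto_iff_tendsto_charFun.1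
      (tendstoInDistribution_inv_sqrt_mul_sum_sub hlaw hT0 hTi hTd).tendsto) 1
    have hlim : charFun (gaussianReal 0 Var[T 0; P].toNNReal) 1 =
        charFun (multivariateGaussian 0 (secondMoment P (X 0))) t := by
      rw [charFun_multivariateGaussian (posSemidef_secondMoment hX), charFun_gaussianReal,
        dotProduct_secondMoment_mulVec hX, hvar, Real.coe_toNNReal _ (by positivity)]
      simp
    have hseq : ∀ n : ℕ,
        charFun (P.map fun ω => (√(n : ℝ))⁻¹ * (∑ k ∈ Finset.range n, T k ω - n * P[T 0])) 1 =
        charFun (P.map fun ω => (√(n : ℝ))⁻¹ • ∑ k ∈ Finset.range n, X k ω) t := by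
      intro n
      rw [charFun_apply, charFun_apply, integral_map, integral_map (hS n)]
      · refine integral_congr_ae (ae_of_all _ fun ω => ?_)
        simp only [T]
        rw [hTm, mul_zero, sub_zero, ← inner_sum, ← real_inner_smul_right, real_inner_comm t]
        simp
      · exact (Measurable.aestronglyMeasurable (by fun_prop))
      · exact ((Finset.aemeasurable_fun_sum _ fun _ _ =>
          (hTd _).aemeasurable_fst).sub_const _).const_mul _
      · exact (Measurable.aestronglyMeasurable (by fun_prop))
    simp only [ProbabilityMeasure.coe_mk, Measure.map_id] at key ⊢
    rw [hlim] at key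
    exact key.congr hseq

end CLT


/-! ### Deterministic estimates: existence of a zero and linearization -/

section Deterministic

variable {E : Type*} [NormedAddCommGroup E] [NormedSpace ℝ E]

/-- A map which is close to an invertible affine map on a ball, and small at the centre, has a
zero in the ball. -/
lemma exists_zero_of_approximatesLinearOn [CompleteSpace E] {F : E → E} {B : E →L[ℝ] E}
    (A : E ≃L[ℝ] E) {ξ : E} {ρ a : ℝ} (hρ : 0 ≤ ρ) (ha : 0 < a) (hA : ‖(A.symm : E →L[ℝ] E)‖ ≤ a)
    (hB : ‖B - A‖ ≤ 1 / (4 * a))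
    (hF : ∀ x ∈ Metric.closedBall ξ ρ, ∀ y ∈ Metric.closedBall ξ ρ,
      ‖F x - F y - B (x - y)‖ ≤ 1 / (4 * a) * ‖x - y‖)
    (hξ : ‖F ξ‖ ≤ ρ / (2 * a)) :
    ∃ x ∈ Metric.closedBall ξ ρ, F x = 0 := by
  -- One `1 / (4 * a)` comes from the nonlinearity of `F`, the other from replacing `B` by `A`. The
  -- image of the ball then contains a ball of radius `(a⁻¹ - c) * ρ = ρ / (2 * a)` about `F ξ`.
  let c : ℝ≥0 := ⟨1 / (2 * a), by positivity⟩
  have happ : ApproximatesLinearOn F (A : E →L[ℝ] E) (Metric.closedBall ξ ρ) c := by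
    intro x hx y hy
    have h1 : F x - F y - (A : E →L[ℝ] E) (x - y) =
        (F x - F y - B (x - y)) + (B - A) (x - y) := by
      simp only [sub_apply]; abel
    rw [h1]
    calc _ ≤ 1 / (4 * a) * ‖x - y‖ + 1 / (4 * a) * ‖x - y‖ :=
          (norm_add_le _ _).trans (add_le_add (hF x hx y hy) ((B - A).le_of_opNorm_le hB _))
      _ = c * ‖x - y‖ := by
          change _ = 1 / (2 * a) * ‖x - y‖
          field_simp; ring
  let R : (A : E →L[ℝ] E).NonlinearRightInverse :=
    { toFun := A.symm
      nnnorm := ⟨a, ha.le⟩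
      bound' := fun y => (A.symm : E →L[ℝ] E).le_of_opNorm_le hA y
      right_inv' := fun y => A.apply_symm_apply y }
  have hsurj := happ.surjOn_closedBall_of_nonlinearRightInverse R hρ subset_rfl
  obtain ⟨x, hx, hx0⟩ := hsurj (show (0 : E) ∈ Metric.closedBall (F ξ) _ by
    rw [mem_closedBall_iff_norm, zero_sub, norm_neg]
    refine hξ.trans (le_of_eq ?_)
    change ρ / (2 * a) = (a⁻¹ - 1 / (2 * a)) * ρ
    field_simp; ring)
  exact ⟨x, hx, hx0⟩

/-- If `Δ` is an approximate zero of a perturbation of the affine map `S + A Δ`, then `s Δ` is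
close to `-s A⁻¹ S`. -/
lemma norm_smul_sub_le_of_linearization (A : E ≃L[ℝ] E) {B : E →L[ℝ] E} {S Δ R : E}
    {s a δ : ℝ} (hs : 0 ≤ s) (hA : ‖(A.symm : E →L[ℝ] E)‖ ≤ a) (heq : S + B Δ + R = 0)
    (hR : ‖R‖ ≤ δ / 2 * ‖Δ‖) (hB : ‖B - A‖ ≤ δ / 2) (hδ0 : 0 ≤ δ) (hδ : a * δ ≤ 1 / 2) :
    ‖s • Δ - s • (-A.symm S)‖ ≤ 2 * (a * δ) * ‖s • (-A.symm S)‖ := by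
  have ha : 0 ≤ a := (norm_nonneg _).trans hA
  have h1 : Δ + A.symm S = A.symm (-((B - A) Δ) - R) := by
    have : A Δ + S = -((B - A) Δ) - R := by
      have hS : S = -(B Δ) - R := by
        rw [eq_comm, ← sub_eq_zero, ← neg_eq_zero, ← heq]; abel
      rw [hS]
      simp only [sub_apply, ContinuousLinearEquiv.coe_coe]; abel
    rw [← this, map_add, A.symm_apply_apply]
  have h2 : ‖Δ + A.symm S‖ ≤ a * δ * ‖Δ‖ := by
    rw [h1]
    calc _ ≤ a * ‖-((B - A) Δ) - R‖ := (A.symm : E →L[ℝ] E).le_of_opNorm_le hA _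
      _ ≤ a * (δ / 2 * ‖Δ‖ + δ / 2 * ‖Δ‖) := by
          gcongr
          refine (norm_sub_le _ _).trans (add_le_add ?_ hR)
          rw [norm_neg]
          exact (B - A).le_of_opNorm_le hB _
      _ = a * δ * ‖Δ‖ := by ring
  have h3 : ‖s • Δ - s • (-A.symm S)‖ = s * ‖Δ + A.symm S‖ := by
    rw [← smul_sub, norm_smul, sub_neg_eq_add, Real.norm_of_nonneg hs]
  -- Since `a * δ ≤ 1 / 2`, the error in `h2` is absorbed into the left side.
  have h4 : ‖Δ‖ ≤ 2 * ‖A.symm S‖ := by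
    have : ‖Δ‖ ≤ ‖Δ + A.symm S‖ + ‖A.symm S‖ := by
      simpa using norm_sub_le (Δ + A.symm S) (A.symm S)
    nlinarith [norm_nonneg Δ]
  rw [h3, norm_smul, norm_neg, Real.norm_of_nonneg hs]
  calc s * ‖Δ + A.symm S‖ ≤ s * (a * δ * (2 * ‖A.symm S‖)) := by gcongr; exact h2.trans (by gcongr)
    _ = _ := by ring

lemma norm_average_sub_sub_le {F G : Type*} [NormedAddCommGroup F] [NormedSpace ℝ F]
    [NormedAddCommGroup G] [NormedSpace ℝ G] {φ : ℕ → F → G} {D : ℕ → F →L[ℝ] G} {K : ℕ → ℝ}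
    {x y : F} {b : ℝ} (n : ℕ) (h : ∀ k, ‖φ k x - φ k y - D k (x - y)‖ ≤ K k * b) :
    ‖(n : ℝ)⁻¹ • ∑ k ∈ Finset.range n, φ k x - (n : ℝ)⁻¹ • ∑ k ∈ Finset.range n, φ k y -
      ((n : ℝ)⁻¹ • ∑ k ∈ Finset.range n, D k) (x - y)‖ ≤
      ((n : ℝ)⁻¹ • ∑ k ∈ Finset.range n, K k) * b := by
  rw [smul_apply, sum_apply, ← smul_sub, ← smul_sub,
    ← Finset.sum_sub_distrib, ← Finset.sum_sub_distrib, norm_smul, norm_inv, RCLike.norm_natCast,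
    smul_eq_mul, mul_assoc, Finset.sum_mul]
  gcongr
  exact norm_sum_le_of_le _ fun k _ => h k

end Deterministic

/-! ### Tightness and convergence in probability -/

section Probability

variable {Ω : Type*} [MeasurableSpace Ω] {P : Measure Ω}

/-- Sequences converging in distribution are bounded in probability. -/
lemma exists_eventually_measure_norm_ge_lt {E Ω' : Type*} [NormedAddCommGroup E]
    [MeasurableSpace E] [BorelSpace E] [MeasurableSpace Ω'] [IsProbabilityMeasure P]
    {P' : Measure Ω'} [IsProbabilityMeasure P'] {X : ℕ → Ω → E} {Z : Ω' → E}
    (h : TendstoInDistribution X atTop Z (fun _ => P) P') {η : ℝ≥0∞} (hη : 0 < η) :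
    ∃ M : ℝ, 0 < M ∧ ∀ᶠ n in atTop, P {ω | M ≤ ‖X n ω‖} < η := by
  have hanti : Antitone fun k : ℕ => {x : E | (k : ℝ) ≤ ‖x‖} := fun i j hij x hx =>
    (show (i : ℝ) ≤ j from Nat.cast_le.2 hij).trans hx
  have hclosed : ∀ k : ℕ, IsClosed {x : E | (k : ℝ) ≤ ‖x‖} := fun k =>
    isClosed_le continuous_const continuous_norm
  have : IsProbabilityMeasure (P'.map Z) := Measure.isProbabilityMeasure_map h.aemeasurable_limit
  have hlim := tendsto_measure_iInter_atTop (μ := P'.map Z)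
    (fun k => (hclosed k).measurableSet.nullMeasurableSet) hanti ⟨0, measure_ne_top _ _⟩
  have hempty : ⋂ k : ℕ, {x : E | (k : ℝ) ≤ ‖x‖} = ∅ := by
    refine Set.eq_empty_of_forall_notMem fun x hx => ?_
    obtain ⟨k, hk⟩ := exists_nat_gt ‖x‖
    exact absurd (Set.mem_iInter.1 hx k) (not_le.2 hk)
  rw [hempty, measure_empty] at hlim
  obtain ⟨k, hk, hk0⟩ := ((hlim.eventually_lt_const hη).and (eventually_gt_atTop 0)).exists
  refine ⟨k, by exact_mod_cast hk0, ?_⟩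
  -- The portmanteau bound for closed sets carries the tail estimate of the limit law over to `X n`.
  have hlimsup := ProbabilityMeasure.limsup_measure_closed_le_of_tendsto h.tendsto (hclosed k)
  filter_upwards [eventually_lt_of_limsup_lt (hlimsup.trans_lt hk)] with n hn
  simp only [ProbabilityMeasure.coe_mk] at hn
  rwa [Measure.map_apply_of_aemeasurable (h.forall_aemeasurable n) (hclosed k).measurableSet] at hn

lemma tendsto_measure_norm_sub_ge {E : Type*} [NormedAddCommGroup E] [IsFiniteMeasure P]
    {X : ℕ → Ω → E} {x : E} (hX : ∀ n, AEStronglyMeasurable (X n) P)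
    (h : ∀ᵐ ω ∂P, Tendsto (fun n => X n ω) atTop (𝓝 x)) {ε : ℝ} (hε : 0 < ε) :
    Tendsto (fun n => P {ω | ε ≤ ‖X n ω - x‖}) atTop (𝓝 0) :=
  tendstoInMeasure_iff_norm.1 (tendstoInMeasure_of_tendsto_ae hX h) ε hε

end Probability

/-! ### Asymptotic normality of abstract Z-estimators -/

section ZEstimator

variable {p : ℕ} {Ω : Type*} [MeasurableSpace Ω] {P : Measure Ω} [IsProbabilityMeasure P]


/-- **Asymptotic normality of Z-estimators.** The random maps `Φ k` have at `ξ` the values `Z k`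
and the derivatives `D k`, and are approximated by their linearizations with the random
constants `K k`. -/
theorem tendstoInDistribution_zEstimator
    {Φ : ℕ → Ω → EuclideanSpace ℝ (Fin p) → EuclideanSpace ℝ (Fin p)} {ξ : EuclideanSpace ℝ (Fin p)}
    {r : ℝ} (hr : 0 < r)
    {Z : ℕ → Ω → EuclideanSpace ℝ (Fin p)}
    {D : ℕ → Ω → EuclideanSpace ℝ (Fin p) →L[ℝ] EuclideanSpace ℝ (Fin p)} {K : ℕ → Ω → ℝ}
    (hZ : ∀ k, ∀ᵐ ω ∂P, Φ k ω ξ = Z k ω)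
    (hΦ : ∀ k, ∀ᵐ ω ∂P, ∀ x ∈ Metric.ball ξ r, ∀ y ∈ Metric.ball ξ r,
      ‖Φ k ω x - Φ k ω y - D k ω (x - y)‖ ≤ K k ω * max ‖x - ξ‖ ‖y - ξ‖ * ‖x - y‖)
    (hZ2 : MemLp (Z 0) 2 P) (hZ0 : ∫ ω, Z 0 ω ∂P = 0) (hZi : iIndepFun Z P)
    (hZd : ∀ k, IdentDistrib (Z k) (Z 0) P P)
    (hD : Integrable (D 0) P) (hDi : iIndepFun D P) (hDd : ∀ k, IdentDistrib (D k) (D 0) P P)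
    (hK : Integrable (K 0) P) (hKi : iIndepFun K P) (hKd : ∀ k, IdentDistrib (K k) (K 0) P P)
    (A : EuclideanSpace ℝ (Fin p) ≃L[ℝ] EuclideanSpace ℝ (Fin p))
    (hA : (A : EuclideanSpace ℝ (Fin p) →L[ℝ] EuclideanSpace ℝ (Fin p)) = ∫ ω, D 0 ω ∂P)
    {est : ℕ → Ω → EuclideanSpace ℝ (Fin p)} (hest : ∀ n, AEMeasurable (est n) P)
    (hsolves : ∀ n, ∀ᵐ ω ∂P, (∃ c ∈ Metric.ball ξ r, ∑ k ∈ Finset.range n, Φ k ω c = 0) →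
      ∑ k ∈ Finset.range n, Φ k ω (est n ω) = 0)
    (hconsistent : TendstoInMeasure P est atTop fun _ => ξ) :
    TendstoInDistribution (fun (n : ℕ) ω => √(n : ℝ) • (est n ω - ξ)) atTop id (fun _ => P)
      (multivariateGaussian 0 (secondMoment P fun ω => A.symm (Z 0 ω))) := by
  have hAm : Measurable fun x : EuclideanSpace ℝ (Fin p) => -A.symm x := by fun_prop
  have hclt := tendstoInDistribution_inv_sqrt_smul_sum (P := P) (X := fun k ω => -A.symm (Z k ω))
    (((A.symm : EuclideanSpace ℝ (Fin p) →L[ℝ] EuclideanSpace ℝ (Fin p)).comp_memLp' hZ2).neg)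
    (by
      rw [integral_neg, neg_eq_zero]
      have := (A.symm : EuclideanSpace ℝ (Fin p) →L[ℝ] EuclideanSpace ℝ (Fin p)).integral_comp_comm
          (hZ2.integrable (by norm_num))
      simpa [hZ0] using this)
    (hZi.comp (fun _ x => -A.symm x) fun _ => hAm) fun k => (hZd k).comp hAm
  have hsm : secondMoment P (fun ω => -A.symm (Z 0 ω)) =
      secondMoment P fun ω => A.symm (Z 0 ω) := by
    ext i j; simp [secondMoment]
  rw [hsm] at hclt
  -- Slutsky: only the difference from the linear term has to vanish in probability.
  refine tendstoInDistribution_of_tendstoInMeasure_sub _ _ hclt ?_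
    fun n => ((hest n).sub_const ξ).fun_const_smul _
  set X : ℕ → Ω → EuclideanSpace ℝ (Fin p) := fun n ω =>
    (√(n : ℝ))⁻¹ • ∑ k ∈ Finset.range n, -A.symm (Z k ω) with hXdef
  let S : ℕ → Ω → EuclideanSpace ℝ (Fin p) := fun n ω => (n : ℝ)⁻¹ • ∑ k ∈ Finset.range n, Z k ω
  let B : ℕ → Ω → EuclideanSpace ℝ (Fin p) →L[ℝ] EuclideanSpace ℝ (Fin p) := fun n ω =>
    (n : ℝ)⁻¹ • ∑ k ∈ Finset.range n, D k ω
  let L : ℕ → Ω → ℝ := fun n ω => (n : ℝ)⁻¹ • ∑ k ∈ Finset.range n, K k ω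
  have hSm : ∀ n, AEMeasurable (S n) P := fun n =>
    (Finset.aemeasurable_fun_sum _ fun k _ => (hZd k).aemeasurable_fst).fun_const_smul _
  have hBm : ∀ n, AEMeasurable (B n) P := fun n =>
    (Finset.aemeasurable_fun_sum _ fun k _ => (hDd k).aemeasurable_fst).fun_const_smul _
  have hLm : ∀ n, AEMeasurable (L n) P := fun n =>
    (Finset.aemeasurable_fun_sum _ fun k _ => (hKd k).aemeasurable_fst).fun_const_smul _
  have hSl : ∀ᵐ ω ∂P, Tendsto (fun n => S n ω) atTop (𝓝 (0 : EuclideanSpace ℝ (Fin p))) := by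
    have := strong_law_ae Z (hZ2.integrable (by norm_num)) (fun i j hij => hZi.indepFun hij) hZd
    rwa [hZ0] at this
  have hBl : ∀ᵐ ω ∂P, Tendsto (fun n => B n ω) atTop
      (𝓝 (A : EuclideanSpace ℝ (Fin p) →L[ℝ] EuclideanSpace ℝ (Fin p))) := by
    have := strong_law_ae D hD (fun i j hij => hDi.indepFun hij) hDd
    rwa [← hA] at this
  have hLl : ∀ᵐ ω ∂P, Tendsto (fun n => L n ω) atTop (𝓝 (∫ ω, K 0 ω ∂P)) :=
    strong_law_ae K hK (fun i j hij => hKi.indepFun hij) hKd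
  -- The added `1` leaves room for `L n` to deviate from its mean by less than `1`. In `a` below, it
  -- ensures positivity even for `p = 0`.
  set ℓ : ℝ := |∫ ω, K 0 ω ∂P| + 1 with hℓ
  have hℓ0 : 0 < ℓ := by positivity
  set a : ℝ := ‖(A.symm : EuclideanSpace ℝ (Fin p) →L[ℝ] EuclideanSpace ℝ (Fin p))‖ + 1 with ha
  have ha0 : 0 < a := by positivity
  have haA : ‖(A.symm : EuclideanSpace ℝ (Fin p) →L[ℝ] EuclideanSpace ℝ (Fin p))‖ ≤ a := by
    rw [ha]; linarith
  obtain ⟨ρ, hρ0, hρr, hρℓ⟩ : ∃ ρ : ℝ, 0 < ρ ∧ ρ < r ∧ ℓ * ρ ≤ 1 / (4 * a) := by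
    refine ⟨min (r / 2) (1 / (4 * a) / ℓ), by positivity, ?_, ?_⟩
    · exact (min_le_left _ _).trans_lt (by linarith)
    · calc ℓ * min (r / 2) (1 / (4 * a) / ℓ) ≤ ℓ * (1 / (4 * a) / ℓ) := by
            gcongr; exact min_le_right _ _
        _ = 1 / (4 * a) := by field_simp
  rw [tendstoInMeasure_iff_norm]
  intro ε hε
  rw [ENNReal.tendsto_nhds_zero]
  intro η hη
  obtain ⟨M, hM0, hM⟩ := exists_eventually_measure_norm_ge_lt hclt (ENNReal.half_pos hη.ne')
  -- The first bound permits the absorption in the linearization lemma; the second makes the final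
  -- error at most `ε / 2` when `‖X n‖ < M`.
  set δ : ℝ := min (1 / (2 * a)) (ε / (4 * a * M)) with hδ
  have hδ0 : 0 < δ := by positivity
  have haδ : a * δ ≤ 1 / 2 := by
    calc a * δ ≤ a * (1 / (2 * a)) := by gcongr; exact min_le_left _ _
      _ = 1 / 2 := by field_simp
  have haδM : 2 * (a * δ) * M ≤ ε / 2 := by
    calc 2 * (a * δ) * M ≤ 2 * (a * (ε / (4 * a * M))) * M := by gcongr; exact min_le_right _ _
      _ = ε / 2 := by field_simp; norm_num
  have h1 := tendsto_measure_norm_sub_ge (fun n => (hSm n).aestronglyMeasurable) hSl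
    (show 0 < ρ / (2 * a) by positivity)
  have h2 := tendsto_measure_norm_sub_ge (fun n => (hBm n).aestronglyMeasurable) hBl
    -- The bound `1 / (4 * a)` serves the existence of a zero, `δ / 2` the linearization.
    (show 0 < min (δ / 2) (1 / (4 * a)) by positivity)
  have h3 := tendsto_measure_norm_sub_ge (fun n => (hLm n).aestronglyMeasurable) hLl one_pos
  -- Within `ρ` the expansion applies to the estimator; within `δ / (2 * ℓ)` its remainder is at
  -- most `δ / 2 * ‖est n ω - ξ‖`.
  have h4 := tendstoInMeasure_iff_norm.1 hconsistent (min ρ (δ / (2 * ℓ))) (by positivity)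
  have h5 := ((h1.add h2).add h3).add h4
  simp only [add_zero] at h5
  filter_upwards [hM, (ENNReal.tendsto_nhds_zero.1 h5) _ (ENNReal.half_pos hη.ne'),
    eventually_gt_atTop 0] with n hn hn' hn0
  rw [← ENNReal.add_halves η]
  refine le_trans ?_ (add_le_add hn.le hn')
  -- Union bound over five bad events: the tail of `X n` costs `η / 2`, the other four together `η /
  -- 2`. Outside them the deviation is below `ε`.
  refine le_trans (measure_mono_ae ?_) ((measure_union_le _ _).trans (add_le_add_right
    ((measure_union_le _ _).trans (add_le_add_left ((measure_union_le _ _).trans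
      (add_le_add_left (measure_union_le _ _) _)) _)) _))
  filter_upwards [ae_all_iff.2 hZ, ae_all_iff.2 hΦ, hsolves n] with ω hZω hΦω hsω hω
  by_contra hgood
  replace hω : ε ≤ ‖√(n : ℝ) • (est n ω - ξ) - X n ω‖ := by
    have h : ε ≤ ‖√(n : ℝ) • (est n ω - ξ) - X n ω - 0‖ := hω
    rwa [sub_zero] at h
  change ¬ (ω ∈ (_ ∪ (_ ∪ _ ∪ _ ∪ _) : Set Ω)) at hgood
  simp only [Set.mem_union, Set.mem_ofPred_eq, not_or, not_le, sub_zero, lt_min_iff] at hgood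
  obtain ⟨hXM, ⟨⟨hSs, hBδ, hBa⟩, hLs⟩, hΔρ, hΔδ⟩ := hgood
  have hL : L n ω ≤ ℓ := by
    rw [Real.norm_eq_abs] at hLs
    have := (abs_lt.1 hLs).2
    have := le_abs_self (∫ ω, K 0 ω ∂P)
    linarith
  have hsub : Metric.closedBall ξ ρ ⊆ Metric.ball ξ r := Metric.closedBall_subset_ball hρr
  let F : EuclideanSpace ℝ (Fin p) → EuclideanSpace ℝ (Fin p) := fun c =>
    (n : ℝ)⁻¹ • ∑ k ∈ Finset.range n, Φ k ω c
  have hFξ : F ξ = S n ω := by simp only [F, S, hZω]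
  have hF : ∀ x ∈ Metric.ball ξ r, ∀ y ∈ Metric.ball ξ r,
      ‖F x - F y - B n ω (x - y)‖ ≤ ℓ * (max ‖x - ξ‖ ‖y - ξ‖ * ‖x - y‖) := fun x hx y hy =>
    (norm_average_sub_sub_le n fun k => (hΦω k x hx y hy).trans_eq (mul_assoc _ _ _)).trans
      (by gcongr)
  have hroot : ∃ c ∈ Metric.closedBall ξ ρ, F c = 0 := by
    refine exists_zero_of_approximatesLinearOn A hρ0.le ha0 haA hBa.le (fun x hx y hy => ?_)
      (hFξ ▸ hSs.le)
    refine (hF x (hsub hx) y (hsub hy)).trans ?_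
    rw [← mul_assoc]
    gcongr
    refine le_trans ?_ hρℓ
    gcongr
    exact max_le (mem_closedBall_iff_norm.1 hx) (mem_closedBall_iff_norm.1 hy)
  have hn1 : (n : ℝ)⁻¹ ≠ 0 := by positivity
  have hest0 : F (est n ω) = 0 := by
    obtain ⟨c, hc, hc0⟩ := hroot
    have := hsω ⟨c, hsub hc, (smul_eq_zero_iff_right hn1).1 hc0⟩
    simp only [F, this, smul_zero]
  have hR : ‖F (est n ω) - F ξ - B n ω (est n ω - ξ)‖ ≤ δ / 2 * ‖est n ω - ξ‖ := by
    refine (hF _ (hsub (mem_closedBall_iff_norm.2 hΔρ.le)) _ (Metric.mem_ball_self hr)).trans ?_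
    rw [sub_self, norm_zero, max_eq_left (norm_nonneg _), ← mul_assoc]
    gcongr
    calc ℓ * ‖est n ω - ξ‖ ≤ ℓ * (δ / (2 * ℓ)) := by gcongr
      _ = δ / 2 := by field_simp
  have hXS : X n ω = √(n : ℝ) • (-A.symm (S n ω)) := by
    simp only [hXdef, S, map_smul, map_sum, Finset.sum_neg_distrib, smul_neg, smul_smul]
    congr 2
    rw [← div_eq_mul_inv, Real.sqrt_div_self']
    simp
  have hfinal := norm_smul_sub_le_of_linearization A (S := S n ω) (B := B n ω)
    (Δ := est n ω - ξ) (Real.sqrt_nonneg n) haA (by rw [hest0, hFξ]; abel) hR hBδ.le hδ0.le haδ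
  rw [← hXS] at hfinal
  have : 2 * (a * δ) * ‖X n ω‖ ≤ 2 * (a * δ) * M := by gcongr
  linarith

end ZEstimator


/-! ### Measurable best constants as countable suprema -/

section SupRatio

variable {X : Type*} [TopologicalSpace X] [TopologicalSpace.SeparableSpace X] [Nonempty X]

open Classical in
/-- The supremum of `num / den` over a countable dense subset of `O`. -/
noncomputable def supRatio (O : Set X) (num den : X → ℝ) : ℝ :=
  (⨆ n : ℕ, if TopologicalSpace.denseSeq X n ∈ O then
    ENNReal.ofReal (num (TopologicalSpace.denseSeq X n)) /
      ENNReal.ofReal (den (TopologicalSpace.denseSeq X n)) else 0).toReal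

lemma supRatio_nonneg (O : Set X) (num den : X → ℝ) : 0 ≤ supRatio O num den :=
  ENNReal.toReal_nonneg

lemma measurable_supRatio {S : Type*} [MeasurableSpace S] (O : Set X) {num : S → X → ℝ}
    (den : X → ℝ) (h : ∀ x, Measurable fun m => num m x) :
    Measurable fun m => supRatio O (num m) den := by
  refine (Measurable.iSup fun n => ?_).ennreal_toReal
  split_ifs
  · exact (h _).ennreal_ofReal.div_const _
  · exact measurable_const

/-- This bound also shows that the supremum is finite, which matters because `toReal` sends `∞` to
`0`. -/
lemma iSup_ratio_le {O : Set X} {num den : X → ℝ} {h : ℝ} (hh : 0 ≤ h)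
    (hle : ∀ x ∈ O, num x ≤ h * den x) :
    (⨆ n : ℕ, open Classical in if TopologicalSpace.denseSeq X n ∈ O then
      ENNReal.ofReal (num (TopologicalSpace.denseSeq X n)) /
        ENNReal.ofReal (den (TopologicalSpace.denseSeq X n)) else 0) ≤ ENNReal.ofReal h := by
  refine iSup_le fun n => ?_
  split_ifs with hn
  · refine ENNReal.div_le_of_le_mul ?_
    rw [← ENNReal.ofReal_mul hh]
    exact ENNReal.ofReal_le_ofReal (hle _ hn)
  · exact zero_le

lemma supRatio_le {O : Set X} {num den : X → ℝ} {h : ℝ} (hh : 0 ≤ h)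
    (hle : ∀ x ∈ O, num x ≤ h * den x) : supRatio O num den ≤ h :=
  ENNReal.toReal_le_of_le_ofReal hh (iSup_ratio_le hh hle)

/-- By continuity, a violation at `x` persists on a neighbourhood, which meets the dense sequence;
there the ratio is one of the terms of the supremum. -/
lemma le_supRatio_mul {O : Set X} (hO : IsOpen O) {num den : X → ℝ} {h : ℝ} (hh : 0 ≤ h)
    (hle : ∀ x ∈ O, num x ≤ h * den x) (hden : ∀ x, 0 ≤ den x)
    (hnumc : ContinuousOn num O) (hdenc : Continuous den) {x : X} (hx : x ∈ O) :
    num x ≤ supRatio O num den * den x := by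
  by_contra! hlt
  have hnhds : {y | y ∈ O ∧ supRatio O num den * den y < num y} ∈ 𝓝 x :=
    (hO.eventually_mem hx).and ((continuousAt_const.mul hdenc.continuousAt).eventually_lt
      (hnumc.continuousAt (hO.mem_nhds hx)) hlt)
  obtain ⟨_, ⟨n, rfl⟩, hnO, hn⟩ :=
    (TopologicalSpace.denseRange_denseSeq X).inter_nhds_nonempty hnhds
  set y := TopologicalSpace.denseSeq X n
  refine absurd hn (not_lt.2 ?_)
  rcases (hden y).eq_or_lt with h0 | h0
  -- Where the denominator vanishes, `hle` forces the numerator to be nonpositive.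
  · rw [← h0, mul_zero]
    simpa [← h0] using hle y hnO
  · have hsup := iSup_ratio_le hh hle
    have htop := ne_top_of_le_ne_top ENNReal.ofReal_ne_top hsup
    have h1 := le_iSup (fun n : ℕ => open Classical in
      if TopologicalSpace.denseSeq X n ∈ O then
        ENNReal.ofReal (num (TopologicalSpace.denseSeq X n)) /
        ENNReal.ofReal (den (TopologicalSpace.denseSeq X n)) else 0) n
    simp only [if_pos (show TopologicalSpace.denseSeq X n ∈ O from hnO)] at h1
    rw [← div_le_iff₀ h0]
    have h2 := ENNReal.toReal_mono htop h1
    rw [← ENNReal.ofReal_div_of_pos h0] at h2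
    rw [ENNReal.toReal_ofReal'] at h2
    exact (le_max_left _ _).trans h2

end SupRatio

/-! ### Derivatives as measurable limits of difference quotients -/

section CoordDeriv

variable {p : ℕ} {F : Type*} [NormedAddCommGroup F] [NormedSpace ℝ F]


lemma sum_proj_smulRight (T : EuclideanSpace ℝ (Fin p) →L[ℝ] F) :
    ∑ j, (EuclideanSpace.proj j : EuclideanSpace ℝ (Fin p) →L[ℝ] ℝ).smulRight
        (T (EuclideanSpace.single j 1)) = T := by
  ext x
  conv_rhs => rw [← (EuclideanSpace.basisFun (Fin p) ℝ).sum_repr x, map_sum]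
  simp

lemma norm_le_sum_norm_single (T : EuclideanSpace ℝ (Fin p) →L[ℝ] F) :
    ‖T‖ ≤ ∑ j, ‖T (EuclideanSpace.single j 1)‖ := by
  refine T.opNorm_le_bound (by positivity) fun x => ?_
  conv_lhs => rw [← (EuclideanSpace.basisFun (Fin p) ℝ).sum_repr x, map_sum]
  rw [Finset.sum_mul]
  refine norm_sum_le_of_le _ fun j _ => ?_
  simp only [EuclideanSpace.basisFun_repr, EuclideanSpace.basisFun_apply, map_smul, norm_smul]
  rw [mul_comm]
  gcongr
  exact PiLp.norm_apply_le x j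

/-- The derivative of `h` at `x`, computed from the partial difference quotients. -/
noncomputable def coordDeriv (h : EuclideanSpace ℝ (Fin p) → F) (x : EuclideanSpace ℝ (Fin p)) :
    EuclideanSpace ℝ (Fin p) →L[ℝ] F :=
  ∑ j, (EuclideanSpace.proj j : EuclideanSpace ℝ (Fin p) →L[ℝ] ℝ).smulRight
      (limUnder atTop fun n : ℕ =>
    ((n : ℝ) + 1) • (h (x + ((n : ℝ) + 1)⁻¹ • EuclideanSpace.single j 1) - h x))

lemma coordDeriv_eq {h : EuclideanSpace ℝ (Fin p) → F} {x : EuclideanSpace ℝ (Fin p)}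
    {T : EuclideanSpace ℝ (Fin p) →L[ℝ] F} (hT : HasFDerivAt h T x) :
    coordDeriv h x = T := by
  rw [← sum_proj_smulRight T]
  refine Finset.sum_congr rfl fun j _ => ?_
  congr 1
  refine Tendsto.limUnder_eq (hT.lim (EuclideanSpace.single j 1) (c := fun n : ℕ => (n : ℝ) + 1) ?_)
  exact tendsto_norm_atTop_atTop.comp
    (tendsto_atTop_add_const_right _ _ tendsto_natCast_atTop_atTop)

/-- Only a sequence of steps `1 / (n + 1)` is involved, and `limUnder` of measurable functions is
measurable even where the limit fails to exist. -/
lemma measurable_coordDeriv {S : Type*} [MeasurableSpace S] [FiniteDimensional ℝ F]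
    [MeasurableSpace F] [BorelSpace F] {h : S → EuclideanSpace ℝ (Fin p) → F}
    (hm : ∀ x, Measurable fun m => h m x)
    (x : EuclideanSpace ℝ (Fin p)) : Measurable fun m => coordDeriv (h m) x := by
  have : CompleteSpace F := FiniteDimensional.complete ℝ F
  refine Finset.measurable_fun_sum _ fun j _ => ?_
  refine (ContinuousLinearMap.smulRightL ℝ (EuclideanSpace ℝ (Fin p)) F
      (EuclideanSpace.proj j)).continuous.measurable.comp ?_
  refine (StronglyMeasurable.limUnder fun n => ?_).measurable
  exact (((hm _).sub (hm _)).const_smul _).stronglyMeasurable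

end CoordDeriv


/-! ### Taylor estimates -/

section Taylor

variable {V W : Type*} [NormedAddCommGroup V] [NormedSpace ℝ V] [NormedAddCommGroup W]
  [NormedSpace ℝ W]

/-- A map with Lipschitz derivative is approximated by its linearization. -/
lemma norm_sub_sub_le_of_lipschitz_fderiv {s : V → W} {U : Set V} {ξ : V} {r h : ℝ}
    (hrU : Metric.ball ξ r ⊆ U) (hh : 0 ≤ h) (hs : ∀ c ∈ U, DifferentiableAt ℝ s c)
    (hLip : ∀ c ∈ U, ∀ c₁ ∈ U, ‖fderiv ℝ s c - fderiv ℝ s c₁‖ ≤ h * ‖c - c₁‖)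
    {x y : V} (hx : x ∈ Metric.ball ξ r) (hy : y ∈ Metric.ball ξ r) :
    ‖s x - s y - fderiv ℝ s ξ (x - y)‖ ≤ h * max ‖x - ξ‖ ‖y - ξ‖ * ‖x - y‖ := by
  have hρ : max ‖x - ξ‖ ‖y - ξ‖ < r :=
    max_lt (mem_ball_iff_norm.1 hx) (mem_ball_iff_norm.1 hy)
  have hsub : Metric.closedBall ξ (max ‖x - ξ‖ ‖y - ξ‖) ⊆ U :=
    (Metric.closedBall_subset_ball hρ).trans hrU
  refine (convex_closedBall ξ (max ‖x - ξ‖ ‖y - ξ‖)).norm_image_sub_le_of_norm_fderiv_le'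
    (fun z hz => hs z (hsub hz)) (fun z hz => ?_) (mem_closedBall_iff_norm.2 (le_max_right _ _))
    (mem_closedBall_iff_norm.2 (le_max_left _ _))
  have hξ : ξ ∈ U := hrU (Metric.mem_ball_self ((norm_nonneg (x - ξ)).trans_lt
    (mem_ball_iff_norm.1 hx)))
  refine (hLip z (hsub hz) ξ hξ).trans ?_
  gcongr
  exact mem_closedBall_iff_norm.1 hz

/-- A quadratic bound survives integration, so this lemma differentiates both `E[W_c]` and `E[Z_c]`
at `ξ`. -/
lemma hasFDerivAt_of_norm_sub_sub_le_sq {g : V → W} {A : V →L[ℝ] W} {ξ : V} {C : ℝ}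
    (h : ∀ᶠ c in 𝓝 ξ, ‖g c - g ξ - A (c - ξ)‖ ≤ C * ‖c - ξ‖ ^ 2) : HasFDerivAt g A ξ := by
  have h1 : HasFDerivAt (fun c => g c - g ξ - A (c - ξ)) (0 : V →L[ℝ] W) ξ := by
    refine Asymptotics.IsBigO.hasFDerivAt (n := 2) (Asymptotics.IsBigO.of_bound C ?_) (by norm_num)
    filter_upwards [h] with c hc
    simpa using hc
  have h2 : HasFDerivAt (fun c => A (c - ξ) + g ξ) A ξ :=
    (A.hasFDerivAt.comp ξ ((hasFDerivAt_id ξ).sub_const ξ)).add_const (g ξ)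
  have h3 := h1.add h2
  rw [zero_add] at h3
  refine h3.congr_of_eventuallyEq (Eventually.of_forall fun c => ?_)
  simp only [Pi.add_apply]
  abel

end Taylor

/-! ### Measurable versions of the score and pathwise expansions -/

section Score

variable {p d : ℕ}


/-- The pathwise regularity of the score of one observed measure `m`: existence on `U`, and
differentiability with a Lipschitz derivative. -/
structure RegularScore (Ξ U : Set (EuclideanSpace ℝ (Fin p)))
    (f : EuclideanSpace ℝ (Fin p) → EuclideanSpace ℝ (Fin d) → ℝ≥0) (h : ℝ)
    (m : Measure (EuclideanSpace ℝ (Fin d))) :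
    Prop where
  nonneg : 0 ≤ h
  scoreExists : ∀ c ∈ U, ScoreExists Ξ f m c
  differentiableAt : ∀ c ∈ U, DifferentiableAt ℝ (score Ξ f m) c
  lipschitz : ∀ c ∈ U, ∀ c₁ ∈ U,
    ‖fderiv ℝ (score Ξ f m) c - fderiv ℝ (score Ξ f m) c₁‖ ≤ h * ‖c - c₁‖

/-- A version of the score on `U` which is a measurable function of the observed measure. -/
noncomputable def scoreVersion (U : Set (EuclideanSpace ℝ (Fin p)))
    (f : EuclideanSpace ℝ (Fin p) → EuclideanSpace ℝ (Fin d) → ℝ≥0)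
    (m : Measure (EuclideanSpace ℝ (Fin d)))
    (c : EuclideanSpace ℝ (Fin p)) : EuclideanSpace ℝ (Fin p) :=
  (InnerProductSpace.toDual ℝ (EuclideanSpace ℝ (Fin p))).symm
  (coordDeriv (U.indicator (loss f m)) c)

/-- A version of the derivative of the score at `ξ` which is a measurable function of the observed
measure. -/
noncomputable def scoreDerivVersion (U : Set (EuclideanSpace ℝ (Fin p)))
    (f : EuclideanSpace ℝ (Fin p) → EuclideanSpace ℝ (Fin d) → ℝ≥0) (ξ : EuclideanSpace ℝ (Fin p))
    (m : Measure (EuclideanSpace ℝ (Fin d))) :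
    EuclideanSpace ℝ (Fin p) →L[ℝ] EuclideanSpace ℝ (Fin p) :=
  coordDeriv (scoreVersion U f m) ξ

/-- The best constant in the approximation of the score by its linearization at `ξ` on the ball of
radius `r`. -/
noncomputable def scoreRemainder (U : Set (EuclideanSpace ℝ (Fin p)))
    (f : EuclideanSpace ℝ (Fin p) → EuclideanSpace ℝ (Fin d) → ℝ≥0) (ξ : EuclideanSpace ℝ (Fin p))
    (r : ℝ) (m : Measure (EuclideanSpace ℝ (Fin d))) : ℝ :=
  supRatio (Metric.ball ξ r ×ˢ Metric.ball ξ r)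
    (fun q : EuclideanSpace ℝ (Fin p) × EuclideanSpace ℝ (Fin p) => ‖scoreVersion U f m q.1 -
        scoreVersion U f m q.2 -
      scoreDerivVersion U f ξ m (q.1 - q.2)‖)
    (fun q => max ‖q.1 - ξ‖ ‖q.2 - ξ‖ * ‖q.1 - q.2‖)

variable {Ξ U : Set (EuclideanSpace ℝ (Fin p))}
    {f : EuclideanSpace ℝ (Fin p) → EuclideanSpace ℝ (Fin d) → ℝ≥0}

lemma measurable_scoreVersion (hf : IsParametricDensity Ξ f) (hUΞ : U ⊆ Ξ)
    (c : EuclideanSpace ℝ (Fin p)) :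
    Measurable fun m : Measure (EuclideanSpace ℝ (Fin d)) => scoreVersion U f m c := by
  refine (InnerProductSpace.toDual ℝ (EuclideanSpace ℝ (Fin p))).symm.continuous.measurable.comp
    (measurable_coordDeriv (fun x => ?_) c)
  -- The difference quotients may leave `Ξ`, where `f x` need not be measurable; the indicator
  -- removes such points.
  by_cases hx : x ∈ U
  · simp only [Set.indicator_of_mem hx]
    exact (Real.measurable_log.comp (Measure.measurable_lintegral
      (hf.measurable x (hUΞ hx)).coe_nnreal_ennreal).ennreal_toReal).neg
  · simp only [Set.indicator_of_notMem hx]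
    exact measurable_const

lemma measurable_scoreDerivVersion (hf : IsParametricDensity Ξ f) (hUΞ : U ⊆ Ξ)
    (ξ : EuclideanSpace ℝ (Fin p)) :
    Measurable fun m : Measure (EuclideanSpace ℝ (Fin d)) => scoreDerivVersion U f ξ m :=
  measurable_coordDeriv (measurable_scoreVersion hf hUΞ) ξ

lemma measurable_scoreRemainder (hf : IsParametricDensity Ξ f) (hUΞ : U ⊆ Ξ)
    (ξ : EuclideanSpace ℝ (Fin p)) (r : ℝ) :
    Measurable fun m : Measure (EuclideanSpace ℝ (Fin d)) => scoreRemainder U f ξ r m := by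
  refine measurable_supRatio _ _ fun q => ?_
  have h := measurable_scoreDerivVersion (d := d) hf hUΞ ξ
  have h1 : Measurable fun m : Measure (EuclideanSpace ℝ (Fin d)) => scoreDerivVersion U f ξ m
      (q.1 - q.2) :=
    h.apply_continuousLinearMap _
  exact (((measurable_scoreVersion hf hUΞ _).sub (measurable_scoreVersion hf hUΞ _)).sub h1).norm

namespace RegularScore

variable {h : ℝ} {m : Measure (EuclideanSpace ℝ (Fin d))} {ξ : EuclideanSpace ℝ (Fin p)} {r : ℝ}

lemma hasFDerivAt_loss (hm : RegularScore Ξ U f h m) (hU : IsOpen U) (hUΞ : U ⊆ Ξ)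
    {c : EuclideanSpace ℝ (Fin p)}
    (hc : c ∈ U) : HasFDerivAt (loss f m)
      (InnerProductSpace.toDual ℝ (EuclideanSpace ℝ (Fin p)) (score Ξ f m c)) c := by
  have hΞ : Ξ ∈ 𝓝 c := mem_of_superset (hU.mem_nhds hc) hUΞ
  have := ((hm.scoreExists c hc).differentiable.differentiableAt hΞ).hasFDerivAt
  rwa [score, gradientWithin, LinearIsometryEquiv.apply_symm_apply, fderivWithin_of_mem_nhds hΞ]

lemma scoreVersion_eq (hm : RegularScore Ξ U f h m) (hU : IsOpen U) (hUΞ : U ⊆ Ξ)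
    {c : EuclideanSpace ℝ (Fin p)}
    (hc : c ∈ U) : scoreVersion U f m c = score Ξ f m c := by
  have h1 : HasFDerivAt (U.indicator (loss f m))
      (InnerProductSpace.toDual ℝ (EuclideanSpace ℝ (Fin p)) (score Ξ f m c)) c :=
    (hm.hasFDerivAt_loss hU hUΞ hc).congr_of_eventuallyEq
      ((hU.eventually_mem hc).mono fun x hx => Set.indicator_of_mem hx _)
  rw [scoreVersion, coordDeriv_eq h1, LinearIsometryEquiv.symm_apply_apply]

lemma scoreDerivVersion_eq (hm : RegularScore Ξ U f h m) (hU : IsOpen U) (hUΞ : U ⊆ Ξ)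
    (hξ : ξ ∈ U) : scoreDerivVersion U f ξ m = fderiv ℝ (score Ξ f m) ξ :=
  coordDeriv_eq ((hm.differentiableAt ξ hξ).hasFDerivAt.congr_of_eventuallyEq
    ((hU.eventually_mem hξ).mono fun _ hx => hm.scoreVersion_eq hU hUΞ hx))

lemma norm_version_sub_le (hm : RegularScore Ξ U f h m) (hU : IsOpen U) (hUΞ : U ⊆ Ξ)
    (hξ : ξ ∈ U) (hr : Metric.ball ξ r ⊆ U)
    {q : EuclideanSpace ℝ (Fin p) × EuclideanSpace ℝ (Fin p)}
    (hq : q ∈ Metric.ball ξ r ×ˢ Metric.ball ξ r) :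
    ‖scoreVersion U f m q.1 - scoreVersion U f m q.2 - scoreDerivVersion U f ξ m (q.1 - q.2)‖ ≤
      h * (max ‖q.1 - ξ‖ ‖q.2 - ξ‖ * ‖q.1 - q.2‖) := by
  rw [hm.scoreVersion_eq hU hUΞ (hr hq.1), hm.scoreVersion_eq hU hUΞ (hr hq.2),
    hm.scoreDerivVersion_eq hU hUΞ hξ, ← mul_assoc]
  exact norm_sub_sub_le_of_lipschitz_fderiv hr hm.nonneg hm.differentiableAt hm.lipschitz hq.1 hq.2

lemma scoreRemainder_le (hm : RegularScore Ξ U f h m) (hU : IsOpen U) (hUΞ : U ⊆ Ξ)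
    (hξ : ξ ∈ U) (hr : Metric.ball ξ r ⊆ U) : scoreRemainder U f ξ r m ≤ h :=
  supRatio_le hm.nonneg fun _ hq => hm.norm_version_sub_le hU hUΞ hξ hr hq

lemma norm_score_sub_le (hm : RegularScore Ξ U f h m) (hU : IsOpen U) (hUΞ : U ⊆ Ξ)
    (hξ : ξ ∈ U) (hr : Metric.ball ξ r ⊆ U) {x y : EuclideanSpace ℝ (Fin p)}
    (hx : x ∈ Metric.ball ξ r)
    (hy : y ∈ Metric.ball ξ r) :
    ‖score Ξ f m x - score Ξ f m y - scoreDerivVersion U f ξ m (x - y)‖ ≤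
      scoreRemainder U f ξ r m * max ‖x - ξ‖ ‖y - ξ‖ * ‖x - y‖ := by
  have hcont : ContinuousOn (scoreVersion U f m) U := fun c hc =>
    ((hm.differentiableAt c hc).continuousAt.congr
      ((hU.eventually_mem hc).mono fun _ hx => (hm.scoreVersion_eq hU hUΞ hx).symm))
      |>.continuousWithinAt
  have h1 : ContinuousOn
      (fun q : EuclideanSpace ℝ (Fin p) × EuclideanSpace ℝ (Fin p) => ‖scoreVersion U f m q.1 -
          scoreVersion U f m q.2 -
      scoreDerivVersion U f ξ m (q.1 - q.2)‖) (Metric.ball ξ r ×ˢ Metric.ball ξ r) := by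
    refine ContinuousOn.norm (ContinuousOn.sub (ContinuousOn.sub ?_ ?_) ?_)
    · exact hcont.comp continuousOn_fst fun q hq => hr hq.1
    · exact hcont.comp continuousOn_snd fun q hq => hr hq.2
    · exact Continuous.continuousOn (by fun_prop)
  have key := le_supRatio_mul (Metric.isOpen_ball.prod Metric.isOpen_ball) hm.nonneg
    (fun _ hq => hm.norm_version_sub_le hU hUΞ hξ hr hq) (fun q => by positivity) h1 (by fun_prop)
    (x := (x, y)) ⟨hx, hy⟩
  simp only [hm.scoreVersion_eq hU hUΞ (hr hx), hm.scoreVersion_eq hU hUΞ (hr hy)] at key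
  rwa [← mul_assoc] at key

/-- The gradient of the loss is the score, whose variation over the ball of radius `‖x - ξ‖` is
linear in that radius; the mean value inequality supplies the second factor `‖x - ξ‖`. -/
lemma abs_loss_sub_le (hm : RegularScore Ξ U f h m) (hU : IsOpen U) (hUΞ : U ⊆ Ξ)
    (hξ : ξ ∈ U) (hr : Metric.ball ξ r ⊆ U) {x : EuclideanSpace ℝ (Fin p)}
    (hx : x ∈ Metric.ball ξ r) :
    |loss f m x - loss f m ξ - inner ℝ (score Ξ f m ξ) (x - ξ)| ≤
      (‖scoreDerivVersion U f ξ m‖ + scoreRemainder U f ξ r m * r) * ‖x - ξ‖ ^ 2 := by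
  have hxr := mem_ball_iff_norm.1 hx
  have hr0 : 0 < r := (norm_nonneg _).trans_lt hxr
  have hsub : Metric.closedBall ξ ‖x - ξ‖ ⊆ Metric.ball ξ r := Metric.closedBall_subset_ball hxr
  have key := (convex_closedBall ξ ‖x - ξ‖).norm_image_sub_le_of_norm_hasFDerivWithin_le'
    (f := loss f m)
    (f' := fun z => InnerProductSpace.toDual ℝ (EuclideanSpace ℝ (Fin p)) (score Ξ f m z))
    (φ := InnerProductSpace.toDual ℝ (EuclideanSpace ℝ (Fin p)) (score Ξ f m ξ))
    (C := (‖scoreDerivVersion U f ξ m‖ + scoreRemainder U f ξ r m * r) * ‖x - ξ‖)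
    (fun z hz => (hm.hasFDerivAt_loss hU hUΞ (hr (hsub hz))).hasFDerivWithinAt) (fun z hz => ?_)
    (Metric.mem_closedBall_self (norm_nonneg _)) (mem_closedBall_iff_norm.2 le_rfl)
  · rw [Real.norm_eq_abs, InnerProductSpace.toDual_apply_apply] at key
    exact key.trans_eq (by ring)
  · have hz' := mem_closedBall_iff_norm.1 hz
    have h1 := hm.norm_score_sub_le hU hUΞ hξ hr (hsub hz) (Metric.mem_ball_self hr0)
    rw [sub_self, norm_zero, max_eq_left (norm_nonneg _)] at h1
    rw [← map_sub, LinearIsometryEquiv.norm_map]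
    have hK := supRatio_nonneg (Metric.ball ξ r ×ˢ Metric.ball ξ r)
      (fun q : EuclideanSpace ℝ (Fin p) × EuclideanSpace ℝ (Fin p) => ‖scoreVersion U f m q.1 -
          scoreVersion U f m q.2 -
        scoreDerivVersion U f ξ m (q.1 - q.2)‖) (fun q => max ‖q.1 - ξ‖ ‖q.2 - ξ‖ * ‖q.1 - q.2‖)
    change 0 ≤ scoreRemainder U f ξ r m at hK
    calc ‖score Ξ f m z - score Ξ f m ξ‖
        ≤ ‖scoreDerivVersion U f ξ m (z - ξ)‖ +
          ‖score Ξ f m z - score Ξ f m ξ - scoreDerivVersion U f ξ m (z - ξ)‖ :=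
          norm_le_insert' _ _
      _ ≤ ‖scoreDerivVersion U f ξ m‖ * ‖z - ξ‖ + scoreRemainder U f ξ r m * r * ‖z - ξ‖ := by
          refine add_le_add (ContinuousLinearMap.le_opNorm _ _) (h1.trans ?_)
          gcongr
          exact hz'.trans hxr.le
      _ ≤ _ := by rw [← add_mul]; gcongr

end RegularScore

end Score


/-! ### Integrability and differentiation of expectations -/

section Moments

variable {p d : ℕ} {Ω : Type*} [MeasurableSpace Ω] {P : Measure Ω}
  {Ξ U : Set (EuclideanSpace ℝ (Fin p))}
  {f : EuclideanSpace ℝ (Fin p) → EuclideanSpace ℝ (Fin d) → ℝ≥0}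
  {μ : Ω → Measure (EuclideanSpace ℝ (Fin d))} {h : Ω → ℝ} {ξ : EuclideanSpace ℝ (Fin p)} {r : ℝ}

lemma scoreRemainder_nonneg (U : Set (EuclideanSpace ℝ (Fin p)))
    (f : EuclideanSpace ℝ (Fin p) → EuclideanSpace ℝ (Fin d) → ℝ≥0)
    (ξ : EuclideanSpace ℝ (Fin p)) (r : ℝ) (m : Measure (EuclideanSpace ℝ (Fin d))) :
    0 ≤ scoreRemainder U f ξ r m :=
  supRatio_nonneg _ _ _

lemma integrable_scoreRemainder (hf : IsParametricDensity Ξ f) (hμ : Measurable μ)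
    (hreg : ∀ᵐ ω ∂P, RegularScore Ξ U f (h ω) (μ ω)) (hU : IsOpen U) (hUΞ : U ⊆ Ξ)
    (hξ : ξ ∈ U) (hr : Metric.ball ξ r ⊆ U) (hh : Integrable h P) :
    Integrable (fun ω => scoreRemainder U f ξ r (μ ω)) P := by
  refine hh.mono ((measurable_scoreRemainder hf hUΞ ξ r).comp hμ).aestronglyMeasurable ?_
  filter_upwards [hreg] with ω hω
  rw [Real.norm_of_nonneg (scoreRemainder_nonneg U f ξ r (μ ω)), Real.norm_of_nonneg hω.nonneg]
  exact hω.scoreRemainder_le hU hUΞ hξ hr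

/-- Applied to a small vector `v`, the derivative is the score increment minus a remainder of size
at most `scoreRemainder * ‖v‖ ^ 2`, and both are integrable. -/
lemma integrable_scoreDerivVersion (hf : IsParametricDensity Ξ f) (hμ : Measurable μ)
    (hreg : ∀ᵐ ω ∂P, RegularScore Ξ U f (h ω) (μ ω)) (hU : IsOpen U) (hUΞ : U ⊆ Ξ)
    (hξ : ξ ∈ U) (hr0 : 0 < r) (hr : Metric.ball ξ r ⊆ U) (hh : Integrable h P)
    (hint : ∀ c ∈ Metric.ball ξ r, Integrable (fun ω => score Ξ f (μ ω) c) P) :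
    Integrable (fun ω => scoreDerivVersion U f ξ (μ ω)) P := by
  have hDm : Measurable fun ω => scoreDerivVersion U f ξ (μ ω) :=
    (measurable_scoreDerivVersion hf hUΞ ξ).comp hμ
  have hK := integrable_scoreRemainder hf hμ hreg hU hUΞ hξ hr hh
  have hsingle : ∀ j, Integrable
      (fun ω => scoreDerivVersion U f ξ (μ ω) (EuclideanSpace.single j 1)) P := by
    intro j
    set v : EuclideanSpace ℝ (Fin p) := (r / 2) • EuclideanSpace.single j 1 with hv
    have hvn : ‖v‖ = r / 2 := by
      rw [hv, norm_smul, PiLp.norm_single, norm_one, mul_one, Real.norm_of_nonneg]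
      positivity
    have hvb : ξ + v ∈ Metric.ball ξ r := by
      rw [mem_ball_iff_norm, add_sub_cancel_left, hvn]; linarith
    have hξb := Metric.mem_ball_self (x := ξ) hr0
    have hrem : Integrable (fun ω => score Ξ f (μ ω) (ξ + v) - score Ξ f (μ ω) ξ -
        scoreDerivVersion U f ξ (μ ω) v) P := by
      refine (hK.mul_const (r / 2 * (r / 2))).mono' ?_ ?_
      · exact (((hint _ hvb).sub (hint _ hξb)).aestronglyMeasurable).sub
          (hDm.apply_continuousLinearMap v).aestronglyMeasurable
      · filter_upwards [hreg] with ω hω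
        have := hω.norm_score_sub_le hU hUΞ hξ hr hvb hξb
        rw [add_sub_cancel_left, sub_self, norm_zero, hvn, max_eq_left (by positivity)] at this
        exact this.trans_eq (mul_assoc _ _ _)
    have hDv : Integrable (fun ω => scoreDerivVersion U f ξ (μ ω) v) P := by
      refine (((hint _ hvb).sub (hint _ hξb)).sub hrem).congr (ae_of_all _ fun ω => ?_)
      simp
    refine (hDv.smul (r / 2)⁻¹).congr (ae_of_all _ fun ω => ?_)
    simp only [hv, Pi.smul_apply, map_smul, smul_smul]
    rw [inv_mul_cancel₀ (by positivity), one_smul]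
  refine (integrable_finsetSum Finset.univ fun j _ => (hsingle j).norm).mono'
    hDm.aestronglyMeasurable (ae_of_all _ fun ω => norm_le_sum_norm_single _)

/-- Differentiation under the integral sign for the expected score. -/
lemma hasFDerivAt_expectedScore (hf : IsParametricDensity Ξ f) (hμ : Measurable μ)
    (hreg : ∀ᵐ ω ∂P, RegularScore Ξ U f (h ω) (μ ω)) (hU : IsOpen U) (hUΞ : U ⊆ Ξ)
    (hξ : ξ ∈ U) (hr0 : 0 < r) (hr : Metric.ball ξ r ⊆ U) (hh : Integrable h P)
    (hint : ∀ c ∈ Metric.ball ξ r, Integrable (fun ω => score Ξ f (μ ω) c) P) :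
    HasFDerivAt (expectedScore P Ξ f μ) (∫ ω, scoreDerivVersion U f ξ (μ ω) ∂P) ξ := by
  have hD := integrable_scoreDerivVersion hf hμ hreg hU hUΞ hξ hr0 hr hh hint
  have hK := integrable_scoreRemainder hf hμ hreg hU hUΞ hξ hr hh
  have hξb := Metric.mem_ball_self (x := ξ) hr0
  refine hasFDerivAt_of_norm_sub_sub_le_sq (C := ∫ ω, scoreRemainder U f ξ r (μ ω) ∂P) ?_
  filter_upwards [Metric.ball_mem_nhds ξ hr0] with c hc
  have hsub : Integrable (fun ω => score Ξ f (μ ω) c - score Ξ f (μ ω) ξ) P :=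
    (hint c hc).sub (hint ξ hξb)
  rw [expectedScore, expectedScore, ← integral_sub (hint c hc) (hint ξ hξb),
    ContinuousLinearMap.integral_apply hD, ← integral_sub hsub
      (hD.apply_continuousLinearMap _), ← integral_mul_const]
  refine norm_integral_le_of_norm_le (hK.mul_const _) ?_
  filter_upwards [hreg] with ω hω
  have := hω.norm_score_sub_le hU hUΞ hξ hr hc hξb
  rw [sub_self, norm_zero, max_eq_left (norm_nonneg _)] at this
  exact this.trans_eq (by ring)

/-- The expected score vanishes at a minimizer of the expected loss. -/
lemma expectedScore_eq_zero (hf : IsParametricDensity Ξ f) (hμ : Measurable μ)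
    (hmin : IsPopulationMinimizer P Ξ f μ ξ)
    (hreg : ∀ᵐ ω ∂P, RegularScore Ξ U f (h ω) (μ ω)) (hU : IsOpen U) (hUΞ : U ⊆ Ξ)
    (hξ : ξ ∈ U) (hr0 : 0 < r) (hr : Metric.ball ξ r ⊆ U) (hh : Integrable h P)
    (hint : ∀ c ∈ Metric.ball ξ r, Integrable (fun ω => score Ξ f (μ ω) c) P) :
    expectedScore P Ξ f μ ξ = 0 := by
  have hD := integrable_scoreDerivVersion hf hμ hreg hU hUΞ hξ hr0 hr hh hint
  have hK := integrable_scoreRemainder hf hμ hreg hU hUΞ hξ hr hh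
  have hZ := hint ξ (Metric.mem_ball_self hr0)
  have hQ := hD.norm.add (hK.mul_const r)
  have hbound : ∀ c ∈ Metric.ball ξ r, ∀ᵐ ω ∂P,
      ‖loss f (μ ω) c - loss f (μ ω) ξ - inner ℝ (score Ξ f (μ ω) ξ) (c - ξ)‖ ≤
      (‖scoreDerivVersion U f ξ (μ ω)‖ + scoreRemainder U f ξ r (μ ω) * r) * ‖c - ξ‖ ^ 2 := by
    intro c hc
    filter_upwards [hreg] with ω hω
    exact hω.abs_loss_sub_le hU hUΞ hξ hr hc
  have hlossm : ∀ c ∈ Metric.ball ξ r, Measurable fun ω => loss f (μ ω) c := fun c hc =>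
    ((Real.measurable_log.comp (Measure.measurable_lintegral
      (hf.measurable c (hUΞ (hr hc))).coe_nnreal_ennreal).ennreal_toReal).neg).comp hμ
  -- Integrability of the loss is assumed at `ξ` only; the pathwise expansion spreads it to the
  -- ball.
  have hloss : ∀ c ∈ Metric.ball ξ r, Integrable (fun ω => loss f (μ ω) c) P := by
    intro c hc
    have hrem : Integrable (fun ω => loss f (μ ω) c - loss f (μ ω) ξ -
        inner ℝ (score Ξ f (μ ω) ξ) (c - ξ)) P :=
      (hQ.mul_const _).mono' (((hlossm c hc).aestronglyMeasurable.sub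
        hmin.integrable.aestronglyMeasurable).sub (hZ.inner_const _).aestronglyMeasurable)
        (hbound c hc)
    refine ((hrem.add (hZ.inner_const (c - ξ))).add hmin.integrable).congr
      (ae_of_all _ fun ω => ?_)
    simp
  have hderiv : HasFDerivAt (fun c => ∫ ω, loss f (μ ω) c ∂P)
      (InnerProductSpace.toDual ℝ _ (expectedScore P Ξ f μ ξ)) ξ := by
    refine hasFDerivAt_of_norm_sub_sub_le_sq (C := ∫ ω, (‖scoreDerivVersion U f ξ (μ ω)‖ +
      scoreRemainder U f ξ r (μ ω) * r) ∂P) ?_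
    filter_upwards [Metric.ball_mem_nhds ξ hr0] with c hc
    have hinner : inner ℝ (expectedScore P Ξ f μ ξ) (c - ξ) =
        ∫ ω, inner ℝ (score Ξ f (μ ω) ξ) (c - ξ) ∂P := by
      simp_rw [real_inner_comm (c - ξ)]
      exact (integral_inner hZ (c - ξ)).symm
    have hsub : Integrable (fun ω => loss f (μ ω) c - loss f (μ ω) ξ) P :=
      (hloss c hc).sub hmin.integrable
    rw [InnerProductSpace.toDual_apply_apply, hinner,
      ← integral_sub (hloss c hc) hmin.integrable,
      ← integral_sub hsub (hZ.inner_const _), ← integral_mul_const]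
    exact norm_integral_le_of_norm_le (hQ.mul_const _) (hbound c hc)
  -- The minimizer is compared only with parameters of finite, integrable loss; on the ball both
  -- conditions hold.
  have hlocal : IsLocalMin (fun c => ∫ ω, loss f (μ ω) c ∂P) ξ := by
    filter_upwards [Metric.ball_mem_nhds ξ hr0] with c hc
    refine hmin.le c (hUΞ (hr hc)) ?_ (hloss c hc)
    filter_upwards [hreg] with ω hω
    have hs := hω.scoreExists c (hr hc)
    exact hs.lossFinite.self_of_nhdsWithin hs.mem
  simpa using hlocal.hasFDerivAt_eq_zero hderiv

end Moments

/-! ### Matrices as linear maps -/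

section Matrix

variable {p : ℕ} {Ω : Type*} [MeasurableSpace Ω] {P : Measure Ω}

lemma secondMoment_toEuclideanCLM {X : Ω → EuclideanSpace ℝ (Fin p)} (hX : MemLp X 2 P)
    (N : Matrix (Fin p) (Fin p) ℝ) :
    secondMoment P (fun ω => Matrix.toEuclideanCLM (𝕜 := ℝ) N (X ω)) =
      N * secondMoment P X * N.transpose := by
  ext i j
  have hint : ∀ k l, Integrable (fun ω => X ω k * X ω l) P := fun k l =>
    (memLp_coord hX k).integrable_mul (memLp_coord hX l)
  have h : ∀ ω, (Matrix.toEuclideanCLM (𝕜 := ℝ) N (X ω)) i *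
      (Matrix.toEuclideanCLM (𝕜 := ℝ) N (X ω)) j =
      ∑ l, ∑ k, N i k * (X ω k * X ω l) * N j l := by
    intro ω
    simp only [Matrix.ofLp_toEuclideanCLM, Matrix.mulVec, dotProduct]
    rw [Finset.sum_mul_sum, Finset.sum_comm]
    refine Finset.sum_congr rfl fun l _ => Finset.sum_congr rfl fun k _ => ?_
    ring
  simp only [secondMoment, Matrix.of_apply, Matrix.mul_apply, Matrix.transpose_apply, h]
  rw [integral_finsetSum _ fun l _ => integrable_finsetSum _ fun k _ =>
    ((hint k l).const_mul _).mul_const _]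
  refine Finset.sum_congr rfl fun l _ => ?_
  rw [integral_finsetSum _ fun k _ => ((hint k l).const_mul _).mul_const _, Finset.sum_mul]
  refine Finset.sum_congr rfl fun k _ => ?_
  rw [integral_mul_const, integral_const_mul]

lemma toEuclideanCLM_of_apply_single
    (T : EuclideanSpace ℝ (Fin p) →L[ℝ] EuclideanSpace ℝ (Fin p)) :
    Matrix.toEuclideanCLM (𝕜 := ℝ)
      (Matrix.of fun i j => T (EuclideanSpace.single j (1 : ℝ)) i) = T := by
  rw [← sum_proj_smulRight T]
  ext x i
  simp [Matrix.ofLp_toEuclideanCLM, Matrix.mulVec, dotProduct, mul_comm]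

/-- The continuous linear equivalence defined by an invertible matrix. -/
noncomputable def euclideanEquivOfIsUnit {M : Matrix (Fin p) (Fin p) ℝ} (hM : IsUnit M) :
    EuclideanSpace ℝ (Fin p) ≃L[ℝ] EuclideanSpace ℝ (Fin p) :=
  have hdet := (Matrix.isUnit_iff_isUnit_det M).1 hM
  ContinuousLinearEquiv.equivOfInverse (Matrix.toEuclideanCLM (𝕜 := ℝ) M)
    (Matrix.toEuclideanCLM (𝕜 := ℝ) M⁻¹)
    (fun x => DFunLike.congr_fun
        (show Matrix.toEuclideanCLM (𝕜 := ℝ) M⁻¹ * Matrix.toEuclideanCLM (𝕜 := ℝ) M = 1 by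
        rw [← map_mul, Matrix.nonsing_inv_mul M hdet, map_one]) x)
    (fun x => DFunLike.congr_fun
        (show Matrix.toEuclideanCLM (𝕜 := ℝ) M * Matrix.toEuclideanCLM (𝕜 := ℝ) M⁻¹ = 1 by
        rw [← map_mul, Matrix.mul_nonsing_inv M hdet, map_one]) x)

end Matrix

end InformedCensoring

/-! ### The main theorem -/

theorem theorem4 {p d : ℕ} {Ω : Type*} [MeasurableSpace Ω] (P : Measure Ω)
    [IsProbabilityMeasure P]
    (Ξ : Set (EuclideanSpace ℝ (Fin p)))
    (f : EuclideanSpace ℝ (Fin p) → EuclideanSpace ℝ (Fin d) → ℝ≥0)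
    (hf : InformedCensoring.IsParametricDensity Ξ f)
    (μ : ℕ → Ω → Measure (EuclideanSpace ℝ (Fin d)))
    (hμ : InformedCensoring.IsRandomMeasureSample P μ)
    (ξ : EuclideanSpace ℝ (Fin p))
    (hξ : InformedCensoring.IsPopulationMinimizer P Ξ f (μ 0) ξ)
    (est : ℕ → Ω → EuclideanSpace ℝ (Fin p))
    (hest : InformedCensoring.IsZEstimator P Ξ f μ est)
    (hconsistent : TendstoInMeasure P est atTop (fun _ => ξ))
    -- existence of `J_ξ`
    (hJ : MemLp (fun ω => InformedCensoring.score Ξ f (μ 0 ω) ξ) 2 P)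
    -- existence and invertibility of `M_ξ`
    (hint : ∀ᶠ c in 𝓝 ξ, Integrable (fun ω => InformedCensoring.score Ξ f (μ 0 ω) c) P)
    (hdiff : DifferentiableAt ℝ (InformedCensoring.expectedScore P Ξ f (μ 0)) ξ)
    (hM : IsUnit (InformedCensoring.matrixM P Ξ f (μ 0) ξ))
    -- differentiability of `c ↦ Z_c` on a fixed neighbourhood of `ξ`
    (U : Set (EuclideanSpace ℝ (Fin p))) (hU : IsOpen U) (hξU : ξ ∈ U) (hUΞ : U ⊆ Ξ)
    (hZ : ∀ k, ∀ᵐ ω ∂P, ∀ c ∈ U, InformedCensoring.ScoreExists Ξ f (μ k ω) c ∧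
      DifferentiableAt ℝ (InformedCensoring.score Ξ f (μ k ω)) c)
    -- Lipschitz condition on the derivative
    (H : ℕ → Ω → ℝ) (hH : ∀ k, Integrable (H k) P)
    (hLip : ∀ k, ∀ᵐ ω ∂P, ∀ c ∈ U, ∀ c₁ ∈ U,
      ‖fderiv ℝ (InformedCensoring.score Ξ f (μ k ω)) c -
        fderiv ℝ (InformedCensoring.score Ξ f (μ k ω)) c₁‖ ≤ H k ω * ‖c - c₁‖) :
    TendstoInDistribution (fun (n : ℕ) ω => √(n : ℝ) • (est n ω - ξ)) atTop id (fun _ => P)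
      (multivariateGaussian 0 (InformedCensoring.matrixV P Ξ f (μ 0) ξ)) := by
  obtain ⟨r, hr0, hrU, hint⟩ : ∃ r > 0, Metric.ball ξ r ⊆ U ∧ ∀ c ∈ Metric.ball ξ r,
      Integrable (fun ω => InformedCensoring.score Ξ f (μ 0 ω) c) P := by
    obtain ⟨r, hr0, hr⟩ := Metric.eventually_nhds_iff_ball.1 ((hU.eventually_mem hξU).and hint)
    exact ⟨r, hr0, fun c hc => (hr c hc).1, fun c hc => (hr c hc).2⟩
  -- Passing to `|H k|` provides the nonnegative constant required by `RegularScore` and keeps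
  -- integrability.
  have hreg : ∀ k, ∀ᵐ ω ∂P, InformedCensoring.RegularScore Ξ U f |H k ω| (μ k ω) := by
    intro k
    filter_upwards [hZ k, hLip k] with ω h1 h2
    exact ⟨abs_nonneg _, fun c hc => (h1 c hc).1, fun c hc => (h1 c hc).2, fun c hc c₁ hc₁ =>
      (h2 c hc c₁ hc₁).trans (by gcongr; exact le_abs_self _)⟩
  have hZm := InformedCensoring.measurable_scoreVersion (d := d) hf hUΞ ξ
  have hDm := InformedCensoring.measurable_scoreDerivVersion (d := d) hf hUΞ ξ
  have hKm := InformedCensoring.measurable_scoreRemainder (d := d) hf hUΞ ξ r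
  have hZeq : ∀ k, ∀ᵐ ω ∂P, InformedCensoring.score Ξ f (μ k ω) ξ =
      InformedCensoring.scoreVersion U f (μ k ω) ξ := fun k =>
    (hreg k).mono fun ω hω => (hω.scoreVersion_eq hU hUΞ hξU).symm
  have hM' : Matrix.toEuclideanCLM (𝕜 := ℝ) (InformedCensoring.matrixM P Ξ f (μ 0) ξ) =
      ∫ ω, InformedCensoring.scoreDerivVersion U f ξ (μ 0 ω) ∂P := by
    rw [InformedCensoring.matrixM, (InformedCensoring.hasFDerivAt_expectedScore hf
      (hμ.measurable 0) (hreg 0) hU hUΞ hξU hr0 hrU (hH 0).abs hint).fderiv]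
    exact InformedCensoring.toEuclideanCLM_of_apply_single _
  have hZ0 : MemLp (fun ω => InformedCensoring.scoreVersion U f (μ 0 ω) ξ) 2 P :=
    (memLp_congr_ae (hZeq 0)).1 hJ
  have key := InformedCensoring.tendstoInDistribution_zEstimator
    (Φ := fun k ω => InformedCensoring.score Ξ f (μ k ω)) hr0 hZeq
    (fun k => (hreg k).mono fun ω hω x hx y hy => hω.norm_score_sub_le hU hUΞ hξU hrU hx hy) hZ0
    ((integral_congr_ae (hZeq 0)).symm.trans (InformedCensoring.expectedScore_eq_zero hf
      (hμ.measurable 0) hξ (hreg 0) hU hUΞ hξU hr0 hrU (hH 0).abs hint))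
    (hμ.indep.comp _ fun _ => hZm) (fun k => (hμ.identDistrib k).comp hZm)
    (InformedCensoring.integrable_scoreDerivVersion hf (hμ.measurable 0) (hreg 0) hU hUΞ hξU hr0
      hrU (hH 0).abs hint)
    (hμ.indep.comp _ fun _ => hDm) (fun k => (hμ.identDistrib k).comp hDm)
    (InformedCensoring.integrable_scoreRemainder hf (hμ.measurable 0) (hreg 0) hU hUΞ hξU hrU
      (hH 0).abs)
    (hμ.indep.comp _ fun _ => hKm) (fun k => (hμ.identDistrib k).comp hKm)
    (InformedCensoring.euclideanEquivOfIsUnit hM) hM' hest.aemeasurable ?_ hconsistent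
  · have hV : InformedCensoring.secondMoment P (fun ω =>
        (InformedCensoring.euclideanEquivOfIsUnit hM).symm
          (InformedCensoring.scoreVersion U f (μ 0 ω) ξ)) =
        InformedCensoring.matrixV P Ξ f (μ 0) ξ := by
      -- The inverse equivalence is by construction the map of `M_ξ⁻¹`, which produces the sandwich
      -- form.
      refine (InformedCensoring.secondMoment_toEuclideanCLM hZ0 _).trans ?_
      rw [InformedCensoring.matrixV]
      congr 2
      ext i j
      refine integral_congr_ae ((hZeq 0).mono fun ω hω => ?_)
      simp only [hω]
    rwa [hV] at key
  · intro n
    filter_upwards [hest.solves n, ae_all_iff.2 hreg] with ω hsol hω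
    rintro ⟨c, hc, hc0⟩
    -- A zero in the ball lies in `U`, where all scores exist, so it is a genuine solution and the
    -- defining property of the estimator applies.
    exact (hsol ⟨c, hUΞ (hrU hc), fun k _ => (hω k).scoreExists c (hrU hc), hc0⟩).2.2
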